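/- For $d\in\mathbb N$ and $t>0$ let $B_t=\{x\in\mathbb R^d:\sum_{i=1}^d|x_i|\le t\}$ be the closed $\ell^1$ ball of radius $t$, and for $f:\mathbb Z^d\to\mathbb C$ let \[ \mathcal M_t f(x)=\frac{1}{|B_t\cap\mathbb Z^d|}\sum_{y\in B_t\cap\mathbb Z^d} f(x-y),\qquad x\in\mathbb Z^d, \] where $|B_t\cap\mathbb Z^d|$ is the number of lattice points in $B_t$. Let $\mathbb D=\{2^n:n=0,1,2,\dots\}$ be the set of dyadic integers. Theorem 1.3. For every integer $d\ge 4$ and every $f\in \ell^2(\mathbb Z^d)$ (complex valued), the function $x\mapsto\sup_{t\in\mathbb D,\ t\le\sqrt d}|\mathcal M_t f(x)|$ belongs to $\ell^2(\mathbb Z^d)$ and \[ \Big\|\sup_{t\in\mathbb D,\ t\le\sqrt d}|\mathcal M_t f|\Big\|_{\ell^2(\mathbb Z^d)}\le 900\,\|f\|_{\ell^2(\mathbb Z^d)}. \] In particular the bound does not depend on the dimension $d$. -/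

import Mathlib

/-- The closed `l¹` ball `B_t = {x ∈ ℝ^d : ∑ |x_i| ≤ t}`. -/
def l1Ball (d : ℕ) (t : ℝ) : Set (Fin d → ℝ) :=
  {x | ∑ i, |x i| ≤ t}

/-- The set `B_t ∩ ℤ^d` of lattice points of the `l¹` ball. -/
def latticeBall (d : ℕ) (t : ℝ) : Set (Fin d → ℤ) :=
  {y | (fun i => (y i : ℝ)) ∈ l1Ball d t}

theorem latticeBall_finite (d : ℕ) (t : ℝ) : (latticeBall d t).Finite := by
  apply (Set.finite_Icc (fun _ : Fin d => -⌊t⌋) (fun _ : Fin d => ⌊t⌋)).subset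
  intro y hy
  have hy' : ∑ i, |(y i : ℝ)| ≤ t := hy
  have h : ∀ i, |y i| ≤ ⌊t⌋ := by
    intro i
    rw [Int.le_floor, Int.cast_abs]
    exact (Finset.single_le_sum (f := fun i => |(y i : ℝ)|)
      (fun j _ => abs_nonneg _) (Finset.mem_univ i)).trans hy'
  exact ⟨fun i => (abs_le.mp (h i)).1, fun i => (abs_le.mp (h i)).2⟩

/-- `B_t ∩ ℤ^d` as a finite set. -/
noncomputable def latticeBallFinset (d : ℕ) (t : ℝ) : Finset (Fin d → ℤ) :=
  (latticeBall_finite d t).toFinset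

/-- The discrete Hardy–Littlewood averaging operator of the `l¹` ball,
`𝓜_t f(x) = |B_t ∩ ℤ^d|⁻¹ ∑_{y ∈ B_t ∩ ℤ^d} f(x - y)`. -/
noncomputable def discreteAvg {d : ℕ} (t : ℝ) (f : (Fin d → ℤ) → ℂ) (x : Fin d → ℤ) : ℂ :=
  (1 / ((latticeBallFinset d t).card : ℂ)) * ∑ y ∈ latticeBallFinset d t, f (x - y)

/-- The dyadic integers `𝔻 = {2^n : n = 0, 1, 2, …}`, as real numbers. -/
def dyadicRadii : Set ℝ :=
  {t | ∃ n : ℕ, t = 2 ^ n}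

/-- The dyadic radii `t ∈ 𝔻` with `t ≤ √d`. -/
def smallDyadicRadii (d : ℕ) : Set ℝ :=
  {t | t ∈ dyadicRadii ∧ t ≤ √(d : ℝ)}

/-- There are only finitely many radii, so the supremum in `smallDyadicMax` is a genuine one. -/
theorem smallDyadicRadii_finite (d : ℕ) : (smallDyadicRadii d).Finite := by
  apply ((Set.finite_Iic d).image (fun n : ℕ => (2 : ℝ) ^ n)).subset
  rintro t ⟨⟨n, rfl⟩, ht⟩
  refine ⟨n, ?_, rfl⟩
  have h1 : (n : ℝ) ≤ 2 ^ n := by exact_mod_cast Nat.lt_two_pow_self.le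
  have h2 := Real.le_sqrt' (x := (2 : ℝ) ^ n) (y := d) (by positivity) |>.mp ht
  have h3 : (1 : ℝ) ≤ 2 ^ n := one_le_pow₀ (by norm_num)
  have h4 : (n : ℝ) ≤ d := by nlinarith
  exact_mod_cast h4

/-- The maximal function `x ↦ sup_{t ∈ 𝔻, t ≤ √d} |𝓜_t f(x)|`. -/
noncomputable def smallDyadicMax {d : ℕ} (f : (Fin d → ℤ) → ℂ) (x : Fin d → ℤ) : ℝ :=
  ⨆ t : smallDyadicRadii d, ‖discreteAvg (t : ℝ) f x‖

/-
Let `Q` be the transition operator of the simple random walk on `ℤ^d`. It is a symmetric,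
positivity-preserving contraction of `ℓ²`, and for every such operator the maximal function
`sup_k Q^k f`, `f ≥ 0`, has norm at most `26 ‖f‖`, whatever `d` is (Stein). Indeed the dyadic
Cesàro means `A_n` of `T = Q²` satisfy `A_n A_m ≤ 2 A_{2m}` for `n ≤ m`, so after linearizing their
maximal function a `TT*` argument turns a bound `K` into the bound `2 √(K + 1)`; iterating brings
any finite bound down to `6`. The difference between `T^n f` and its Cesàro mean is controlled by
the square function `(∑ (k + 1) |T^k f - T^(k + 1) f|²)^(1/2)`, whose norm is at most `‖f‖`.

If `N² ≤ d`, then `B_N` has at least `(2d)^N / (2 N!)` points, already among the vectors with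
entries `0, ±1`. Hence the sum of `f(x - z)` over such vectors `z` with `N - j` nonzero entries,
divided by `|B_N ∩ ℤ^d|`, is at most `2 (N / 2d)^j Q^(N - j) f(x)`. A general point of `B_N` is the
sum of a vector of this kind and a sparse vector `y` without entries `±1`. The latter forces
`j ≥ ∑ |y_i|`, and because `N / 2d ≤ 1 / (2 √d)` the total weight of the sparse vectors is at most
`e`.
-/

open scoped InnerProductSpace lp

section L2

variable {X ι : Type*}

theorem l2_hasSum_sq (f : ℓ²(X, ℝ)) : HasSum (fun x => f x ^ 2) (‖f‖ ^ 2) := by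
  simpa using lp.hasSum_norm (p := 2) (by simp) f

theorem memℓp_two_of_summable_sq {u : X → ℝ} (hu : Summable fun x => u x ^ 2) : Memℓp u 2 :=
  memℓp_gen (by simpa using hu)

theorem l2_inner_nonneg {f g : ℓ²(X, ℝ)} (hf : 0 ≤ ⇑f) (hg : 0 ≤ ⇑g) : 0 ≤ ⟪f, g⟫_ℝ := by
  rw [lp.inner_eq_tsum]
  exact tsum_nonneg fun x => mul_nonneg (hg x) (hf x)

theorem l2_inner_le_inner {f g h : ℓ²(X, ℝ)} (hf : 0 ≤ ⇑f) (hgh : ⇑g ≤ ⇑h) :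
    ⟪f, g⟫_ℝ ≤ ⟪f, h⟫_ℝ := by
  rw [← sub_nonneg, ← inner_sub_right]
  exact l2_inner_nonneg hf fun x => sub_nonneg.mpr (hgh x)

theorem l2_sum_apply (s : Finset ι) (g : ι → ℓ²(X, ℝ)) (x : X) :
    (∑ i ∈ s, g i) x = ∑ i ∈ s, g i x := by
  rw [lp.coeFn_sum, Finset.sum_apply]

theorem exists_l2_sqrt_sum_sq (s : Finset ι) {w : ι → ℝ} (hw : ∀ i ∈ s, 0 ≤ w i)
    (D : ι → ℓ²(X, ℝ)) :
    ∃ S : ℓ²(X, ℝ), (∀ x, S x = √(∑ i ∈ s, w i * D i x ^ 2)) ∧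
      ‖S‖ ^ 2 = ∑ i ∈ s, w i * ‖D i‖ ^ 2 := by
  have hsq : ∀ x, √(∑ i ∈ s, w i * D i x ^ 2) ^ 2 = ∑ i ∈ s, w i * D i x ^ 2 := fun x =>
    Real.sq_sqrt (Finset.sum_nonneg fun i hi => mul_nonneg (hw i hi) (sq_nonneg _))
  have hsum : HasSum (fun x => √(∑ i ∈ s, w i * D i x ^ 2) ^ 2) (∑ i ∈ s, w i * ‖D i‖ ^ 2) := by
    simp only [hsq]
    exact hasSum_sum fun i _ => (l2_hasSum_sq (D i)).mul_left (w i)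
  exact ⟨⟨_, memℓp_two_of_summable_sq hsum.summable⟩, fun _ => rfl,
    (l2_hasSum_sq _).unique hsum⟩

/-- The restriction of `f` to `A`, extended by zero. -/
noncomputable def l2Restrict (A : Set X) (f : ℓ²(X, ℝ)) : ℓ²(X, ℝ) :=
  ⟨A.indicator f, (lp.memℓp f).mono' fun _ => norm_indicator_le_norm_self _ _⟩

theorem exists_l2_partition_of_max {s : Finset ι} (hs : s.Nonempty) {g : ι → ℓ²(X, ℝ)}
    (hg : ∀ i, 0 ≤ ⇑(g i)) :
    ∃ P : ι → ℓ²(X, ℝ), (∀ i, 0 ≤ ⇑(P i)) ∧ (∀ i ∈ s, ⇑(g i) ≤ ⇑(∑ j ∈ s, P j)) ∧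
      ‖∑ i ∈ s, P i‖ ^ 2 = ∑ i ∈ s, ⟪P i, g i⟫_ℝ := by
  choose ν hνs hν using fun x => s.exists_max_image (fun i => g i x) hs
  set P : ι → ℓ²(X, ℝ) := fun i => l2Restrict {x | ν x = i} (g i)
  have hsum : ∀ x, (∑ i ∈ s, P i) x = g (ν x) x := fun x => by
    rw [l2_sum_apply, Finset.sum_eq_single_of_mem (ν x) (hνs x)]
    · simp [P, l2Restrict]
    · intro i _ hi
      simp [P, l2Restrict, hi.symm]
  have hinner : ∀ i, ⟪P i, ∑ j ∈ s, P j⟫_ℝ = ⟪P i, g i⟫_ℝ := fun i => by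
    rw [lp.inner_eq_tsum, lp.inner_eq_tsum]
    refine tsum_congr fun x => ?_
    rw [hsum]
    by_cases hx : ν x = i
    · rw [hx]
    · simp [P, l2Restrict, hx]
  refine ⟨P, fun i => Set.indicator_nonneg fun x _ => hg i x, fun i hi x => ?_, ?_⟩
  · rw [hsum]
    exact hν x i hi
  · rw [← real_inner_self_eq_norm_sq, sum_inner]
    exact Finset.sum_congr rfl fun i _ => hinner i

end L2

/-- Symmetric, positivity-preserving contractions of `ℓ²(X)`: the operators to which Stein's
maximal theorem applies. -/
structure IsSymmPosContraction {X : Type*} (T : ℓ²(X, ℝ) →ₗ[ℝ] ℓ²(X, ℝ)) : Prop where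
  isSymmetric : T.IsSymmetric
  nonneg : ∀ f : ℓ²(X, ℝ), 0 ≤ ⇑f → 0 ≤ ⇑(T f)
  norm_le : ∀ f : ℓ²(X, ℝ), ‖T f‖ ≤ ‖f‖

namespace IsSymmPosContraction

variable {X ι : Type*} {T : ℓ²(X, ℝ) →ₗ[ℝ] ℓ²(X, ℝ)}

theorem pow (hT : IsSymmPosContraction T) (k : ℕ) : IsSymmPosContraction (T ^ k) where
  isSymmetric := hT.isSymmetric.pow k
  nonneg f hf := by
    induction k with
    | zero => exact hf
    | succ k ih =>
      rw [pow_succ', Module.End.mul_apply]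
      exact hT.nonneg _ ih
  norm_le f := by
    induction k with
    | zero => exact le_rfl
    | succ k ih =>
      rw [pow_succ', Module.End.mul_apply]
      exact (hT.norm_le _).trans ih

theorem weighted_sum {s : Finset ι} {w : ι → ℝ} (hw : ∀ i ∈ s, 0 ≤ w i) (hw1 : ∑ i ∈ s, w i ≤ 1)
    {S : ι → ℓ²(X, ℝ) →ₗ[ℝ] ℓ²(X, ℝ)} (hS : ∀ i ∈ s, IsSymmPosContraction (S i)) :
    IsSymmPosContraction (∑ i ∈ s, w i • S i) where
  isSymmetric f g := by
    simp only [LinearMap.sum_apply, LinearMap.smul_apply, sum_inner, inner_sum,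
      real_inner_smul_left, real_inner_smul_right]
    exact Finset.sum_congr rfl fun i hi => by rw [(hS i hi).isSymmetric f g]
  nonneg f hf x := by
    rw [LinearMap.sum_apply, l2_sum_apply]
    exact Finset.sum_nonneg fun i hi => mul_nonneg (hw i hi) ((hS i hi).nonneg f hf x)
  norm_le f := calc
    ‖(∑ i ∈ s, w i • S i) f‖ ≤ ∑ i ∈ s, w i * ‖f‖ := by
      rw [LinearMap.sum_apply]
      refine norm_sum_le_of_le s fun i hi => ?_
      rw [LinearMap.smul_apply, norm_smul, Real.norm_of_nonneg (hw i hi)]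
      exact mul_le_mul_of_nonneg_left ((hS i hi).norm_le f) (hw i hi)
    _ ≤ ‖f‖ := by
      rw [← Finset.sum_mul]
      exact mul_le_of_le_one_left (norm_nonneg f) hw1

end IsSymmPosContraction

/-- The Cesàro mean `N⁻¹ ∑_{k < N} T ^ k`, which is `0` for `N = 0`. -/
noncomputable def cesaroMean {E : Type*} [AddCommGroup E] [Module ℝ E] (T : E →ₗ[ℝ] E) (N : ℕ) :
    E →ₗ[ℝ] E :=
  ∑ k ∈ Finset.range N, (N : ℝ)⁻¹ • T ^ k

theorem cesaroMean_apply_apply {X : Type*} (T : ℓ²(X, ℝ) →ₗ[ℝ] ℓ²(X, ℝ)) (N : ℕ) (f : ℓ²(X, ℝ))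
    (x : X) : cesaroMean T N f x = (N : ℝ)⁻¹ * ∑ k ∈ Finset.range N, (T ^ k) f x := by
  rw [cesaroMean, LinearMap.sum_apply, l2_sum_apply, Finset.mul_sum]
  rfl

/-- The dyadic Cesàro means `A_{2 ^ n} f`, `n ≤ J`, of every nonnegative `f` have a common majorant
of norm at most `K * ‖f‖`. -/
def HasDyadicCesaroBound {X : Type*} (T : ℓ²(X, ℝ) →ₗ[ℝ] ℓ²(X, ℝ)) (J : ℕ) (K : ℝ) : Prop :=
  ∀ f : ℓ²(X, ℝ), 0 ≤ ⇑f →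
    ∃ C : ℓ²(X, ℝ), ‖C‖ ≤ K * ‖f‖ ∧ ∀ n ≤ J, ⇑(cesaroMean T (2 ^ n) f) ≤ ⇑C

namespace IsSymmPosContraction

variable {X : Type*} {T : ℓ²(X, ℝ) →ₗ[ℝ] ℓ²(X, ℝ)}

protected theorem cesaroMean (hT : IsSymmPosContraction T) (N : ℕ) :
    IsSymmPosContraction (cesaroMean T N) :=
  weighted_sum (fun _ _ => by positivity) (by simpa using mul_inv_le_one) fun k _ => hT.pow k

theorem pow_cesaroMean_le (hT : IsSymmPosContraction T) {j n N : ℕ} (hjn : j + n ≤ N)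
    (hN : N ≤ 2 * n) {f : ℓ²(X, ℝ)} (hf : 0 ≤ ⇑f) :
    ⇑((T ^ j) (cesaroMean T n f)) ≤ ⇑((2 : ℝ) • cesaroMean T N f) := by
  intro x
  have hinv : (n : ℝ)⁻¹ ≤ 2 * (N : ℝ)⁻¹ := by
    rcases n.eq_zero_or_pos with rfl | hn
    · simp
    · have hN0 : (0 : ℝ) < N := by exact_mod_cast (by omega : 0 < N)
      rw [← div_eq_mul_inv, inv_le_comm₀ (by positivity) (by positivity), inv_div,
        div_le_iff₀ two_pos]
      exact_mod_cast (by omega : N ≤ n * 2)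
  have hterms : ∑ k ∈ Finset.range n, (T ^ (j + k)) f x ≤ ∑ k ∈ Finset.range N, (T ^ k) f x := by
    have hIco := Finset.sum_Ico_eq_sum_range (fun k => (T ^ k) f x) j (j + n)
    rw [Nat.add_sub_cancel_left] at hIco
    rw [← hIco, Finset.range_eq_Ico]
    exact Finset.sum_le_sum_of_subset_of_nonneg (Finset.Ico_subset_Ico j.zero_le hjn)
      fun k _ _ => (hT.pow k).nonneg f hf x
  calc (T ^ j) (cesaroMean T n f) x
      = (n : ℝ)⁻¹ * ∑ k ∈ Finset.range n, (T ^ (j + k)) f x := by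
        simp only [cesaroMean, LinearMap.sum_apply, LinearMap.smul_apply, map_sum, map_smul,
          l2_sum_apply, Finset.mul_sum, pow_add, Module.End.mul_apply]
        rfl
    _ ≤ 2 * (N : ℝ)⁻¹ * ∑ k ∈ Finset.range N, (T ^ k) f x := by
        gcongr
        exact Finset.sum_nonneg fun k _ => (hT.pow _).nonneg f hf x
    _ = 2 * cesaroMean T N f x := by rw [cesaroMean_apply_apply, mul_assoc]

theorem cesaroMean_cesaroMean_le (hT : IsSymmPosContraction T) {n m : ℕ} (hnm : n ≤ m)
    {f : ℓ²(X, ℝ)} (hf : 0 ≤ ⇑f) :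
    ⇑(cesaroMean T n (cesaroMean T m f)) ≤ ⇑((2 : ℝ) • cesaroMean T (2 * m) f) := by
  intro x
  have hterm : ∀ j ∈ Finset.range n,
      (T ^ j) (cesaroMean T m f) x ≤ ((2 : ℝ) • cesaroMean T (2 * m) f) x := fun j hj =>
    hT.pow_cesaroMean_le (by have := Finset.mem_range.mp hj; omega) le_rfl hf x
  have hnonneg : 0 ≤ ((2 : ℝ) • cesaroMean T (2 * m) f) x :=
    mul_nonneg two_pos.le ((hT.cesaroMean _).nonneg f hf x)
  rw [cesaroMean_apply_apply]
  calc _ ≤ (n : ℝ)⁻¹ * (n * ((2 : ℝ) • cesaroMean T (2 * m) f) x) := by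
        gcongr
        simpa using Finset.sum_le_sum hterm
    _ ≤ _ := by
        rw [← mul_assoc]
        exact mul_le_of_le_one_left hnonneg inv_mul_le_one

theorem norm_sum_cesaroMean_sq_le (hT : IsSymmPosContraction T) (s : Finset ℕ)
    {P : ℕ → ℓ²(X, ℝ)} (hP : ∀ n, 0 ≤ ⇑(P n)) :
    ‖∑ n ∈ s, cesaroMean T (2 ^ n) (P n)‖ ^ 2 ≤
      4 * ∑ n ∈ s, ⟪P n, cesaroMean T (2 ^ (n + 1)) (∑ m ∈ s, P m)⟫_ℝ := by
  set b : ℕ → ℕ → ℝ := fun n m => ⟪P n, cesaroMean T (2 ^ (n + 1)) (P m)⟫_ℝ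
  have hb : ∀ n m, 0 ≤ b n m := fun n m =>
    l2_inner_nonneg (hP n) ((hT.cesaroMean _).nonneg _ (hP m))
  have hle : ∀ {n m : ℕ}, n ≤ m →
      ⟪cesaroMean T (2 ^ n) (P n), cesaroMean T (2 ^ m) (P m)⟫_ℝ ≤ 2 * b m n := fun {n m} hnm =>
    calc
    _ = ⟪P n, cesaroMean T (2 ^ n) (cesaroMean T (2 ^ m) (P m))⟫_ℝ :=
      (hT.cesaroMean _).isSymmetric _ _
    _ ≤ ⟪P n, (2 : ℝ) • cesaroMean T (2 * 2 ^ m) (P m)⟫_ℝ :=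
      l2_inner_le_inner (hP n)
        (hT.cesaroMean_cesaroMean_le (pow_le_pow_right₀ one_le_two hnm) (hP m))
    _ = 2 * b m n := by
      rw [real_inner_smul_right, ← pow_succ', ← (hT.cesaroMean _).isSymmetric, real_inner_comm]
  have hpair : ∀ n m, ⟪cesaroMean T (2 ^ n) (P n), cesaroMean T (2 ^ m) (P m)⟫_ℝ ≤
      2 * b n m + 2 * b m n := fun n m => by
    rcases le_total n m with h | h
    · linarith [hle h, hb n m]
    · rw [real_inner_comm]
      linarith [hle h, hb m n]
  calc ‖∑ n ∈ s, cesaroMean T (2 ^ n) (P n)‖ ^ 2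
      = ∑ n ∈ s, ∑ m ∈ s, ⟪cesaroMean T (2 ^ n) (P n), cesaroMean T (2 ^ m) (P m)⟫_ℝ := by
        rw [← real_inner_self_eq_norm_sq, sum_inner]
        simp only [inner_sum]
    _ ≤ ∑ n ∈ s, ∑ m ∈ s, (2 * b n m + 2 * b m n) :=
        Finset.sum_le_sum fun n _ => Finset.sum_le_sum fun m _ => hpair n m
    _ = 4 * ∑ n ∈ s, ∑ m ∈ s, b n m := by
        simp only [Finset.sum_add_distrib, ← Finset.mul_sum]
        rw [Finset.sum_comm (f := fun n m => b m n)]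
        ring
    _ = _ := by simp only [b, map_sum, inner_sum]

theorem norm_sum_cesaroMean_le (hT : IsSymmPosContraction T) {J : ℕ} {K L : ℝ}
    (hK : HasDyadicCesaroBound T J K) (hL : 0 ≤ L) (hKL : 4 * (K + 1) ≤ L ^ 2)
    {P : ℕ → ℓ²(X, ℝ)} (hP : ∀ n, 0 ≤ ⇑(P n)) :
    ‖∑ n ∈ Finset.range (J + 1), cesaroMean T (2 ^ n) (P n)‖ ≤
      L * ‖∑ n ∈ Finset.range (J + 1), P n‖ := by
  set F := ∑ n ∈ Finset.range (J + 1), P n with hF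
  have hF0 : 0 ≤ ⇑F := fun x => by
    rw [hF, l2_sum_apply]
    exact Finset.sum_nonneg fun n _ => hP n x
  obtain ⟨C, hCnorm, hC⟩ := hK F hF0
  have hA0 : ∀ N, 0 ≤ ⇑(cesaroMean T N F) := fun N => (hT.cesaroMean N).nonneg F hF0
  set D := C + cesaroMean T (2 ^ (J + 1)) F
  have hD : ∀ n ∈ Finset.range (J + 1), ⇑(cesaroMean T (2 ^ (n + 1)) F) ≤ ⇑D := fun n hn => by
    rcases (Nat.le_of_lt_succ (Finset.mem_range.mp hn)).lt_or_eq with hlt | rfl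
    · exact le_add_of_le_of_nonneg (hC (n + 1) hlt) (hA0 _)
    · exact le_add_of_nonneg_left ((hA0 _).trans (hC 0 n.zero_le))
  have hDnorm : ‖D‖ ≤ (K + 1) * ‖F‖ := by
    linarith [norm_add_le C (cesaroMean T (2 ^ (J + 1)) F), (hT.cesaroMean (2 ^ (J + 1))).norm_le F]
  refine le_of_sq_le_sq ?_ (by positivity)
  calc _ ≤ 4 * ∑ n ∈ Finset.range (J + 1), ⟪P n, cesaroMean T (2 ^ (n + 1)) F⟫_ℝ :=
        hT.norm_sum_cesaroMean_sq_le _ hP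
    _ ≤ 4 * ∑ n ∈ Finset.range (J + 1), ⟪P n, D⟫_ℝ := by
        gcongr with n hn
        exact l2_inner_le_inner (hP n) (hD n hn)
    _ = 4 * ⟪F, D⟫_ℝ := by rw [hF, sum_inner]
    _ ≤ 4 * (‖F‖ * ((K + 1) * ‖F‖)) := by
        gcongr
        exact (real_inner_le_norm _ _).trans (by gcongr)
    _ = 4 * (K + 1) * ‖F‖ ^ 2 := by ring
    _ ≤ (L * ‖F‖) ^ 2 := by
        rw [mul_pow]
        gcongr

theorem hasDyadicCesaroBound_add_one (hT : IsSymmPosContraction T) (J : ℕ) :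
    HasDyadicCesaroBound T J (J + 1) := by
  intro f hf
  refine ⟨∑ n ∈ Finset.range (J + 1), cesaroMean T (2 ^ n) f, ?_, fun n hn x => ?_⟩
  · refine (norm_sum_le_of_le _ fun n _ => (hT.cesaroMean _).norm_le f).trans_eq ?_
    simp
  · rw [l2_sum_apply]
    exact Finset.single_le_sum (f := fun n => cesaroMean T (2 ^ n) f x)
      (fun m _ => (hT.cesaroMean _).nonneg f hf x) (Finset.mem_range_succ_iff.mpr hn)

theorem hasDyadicCesaroBound_of_sq (hT : IsSymmPosContraction T) {J : ℕ} {K L : ℝ}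
    (hK : HasDyadicCesaroBound T J K) (hL : 0 ≤ L) (hKL : 4 * (K + 1) ≤ L ^ 2) :
    HasDyadicCesaroBound T J L := by
  intro f hf
  obtain ⟨P, hP, hmax, hnorm⟩ := exists_l2_partition_of_max (Finset.nonempty_range_add_one (n := J))
    fun n => (hT.cesaroMean (2 ^ n)).nonneg f hf
  set F := ∑ n ∈ Finset.range (J + 1), P n
  refine ⟨F, ?_, fun n hn => hmax n (Finset.mem_range_succ_iff.mpr hn)⟩
  have hsq : ‖F‖ * ‖F‖ ≤ ‖F‖ * (L * ‖f‖) := calc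
    ‖F‖ * ‖F‖ = ⟪∑ n ∈ Finset.range (J + 1), cesaroMean T (2 ^ n) (P n), f⟫_ℝ := by
      rw [← sq, hnorm, sum_inner]
      exact Finset.sum_congr rfl fun n _ => ((hT.cesaroMean _).isSymmetric _ _).symm
    _ ≤ L * ‖F‖ * ‖f‖ := (real_inner_le_norm _ _).trans (by
      gcongr
      exact hT.norm_sum_cesaroMean_le hK hL hKL hP)
    _ = ‖F‖ * (L * ‖f‖) := by ring
  rcases (norm_nonneg F).eq_or_lt with hF | hF
  · rw [← hF]
    positivity
  · exact le_of_mul_le_mul_left hsq hF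

theorem hasDyadicCesaroBound_six (hT : IsSymmPosContraction T) (J : ℕ) :
    HasDyadicCesaroBound T J 6 := by
  have descent : ∀ j : ℕ, HasDyadicCesaroBound T J (j + 6) → HasDyadicCesaroBound T J 6 := by
    intro j
    induction j with
    | zero => simp
    | succ j ih =>
      exact fun h => ih (hT.hasDyadicCesaroBound_of_sq h (by positivity) (by push_cast; nlinarith))
  refine descent J fun f hf => ?_
  obtain ⟨C, hC, hle⟩ := hT.hasDyadicCesaroBound_add_one J f hf
  exact ⟨C, hC.trans (by gcongr; norm_num), hle⟩

end IsSymmPosContraction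

section SquareFunction

theorem sum_succ_mul_second_difference_le {b : ℕ → ℝ} (hb0 : ∀ j, 0 ≤ b j) (hb : Antitone b)
    (hconv : ∀ j, 0 ≤ b j - 2 * b (j + 1) + b (j + 2)) (n : ℕ) :
    ∑ k ∈ Finset.range n, ((k : ℝ) + 1) * (b (2 * k) - 2 * b (2 * k + 1) + b (2 * k + 2)) ≤
      b 0 := by
  have invariant : ∀ n : ℕ,
      ∑ k ∈ Finset.range n, ((k : ℝ) + 1) * (b (2 * k) - 2 * b (2 * k + 1) + b (2 * k + 2)) ≤
        b 0 - (2 * n + 1) * b (2 * n) + 2 * n * b (2 * n + 1) := by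
    intro n
    induction n with
    | zero => simp
    | succ n ih =>
      rw [Finset.sum_range_succ]
      have hodd := mul_nonneg (by positivity : (0 : ℝ) ≤ 2 * n + 2) (hconv (2 * n + 1))
      have heven := mul_nonneg n.cast_nonneg (hconv (2 * n))
      rw [show 2 * (n + 1) + 1 = 2 * n + 1 + 2 by ring, show 2 * (n + 1) = 2 * n + 2 by ring]
      push_cast
      linarith
  have hlast := mul_nonneg (by positivity : (0 : ℝ) ≤ 2 * n)
    (sub_nonneg.mpr (hb (2 * n).le_succ))
  linarith [invariant n, hb0 (2 * n)]

theorem sum_succ_mul_norm_pow_sub_pow_sq_le {E : Type*} [NormedAddCommGroup E]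
    [InnerProductSpace ℝ E] {Q : E →ₗ[ℝ] E} (hQ : Q.IsSymmetric) (hQ1 : ∀ f, ‖Q f‖ ≤ ‖f‖)
    (f : E) (n : ℕ) :
    ∑ k ∈ Finset.range n, ((k : ℝ) + 1) * ‖(Q ^ (2 * k)) f - (Q ^ (2 * k + 2)) f‖ ^ 2 ≤
      ‖f‖ ^ 2 := by
  have hsucc : ∀ j, (Q ^ (j + 1)) f = Q ((Q ^ j) f) := fun j => by
    rw [pow_succ', Module.End.mul_apply]
  have hdiff : ∀ j, ‖(Q ^ j) f - (Q ^ (j + 2)) f‖ ^ 2 =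
      ‖(Q ^ j) f‖ ^ 2 - 2 * ‖(Q ^ (j + 1)) f‖ ^ 2 + ‖(Q ^ (j + 2)) f‖ ^ 2 := fun j => by
    rw [norm_sub_sq_real, hsucc (j + 1), ← hQ, ← hsucc, real_inner_self_eq_norm_sq]
  simp only [hdiff]
  refine sum_succ_mul_second_difference_le (b := fun j => ‖(Q ^ j) f‖ ^ 2) (fun j => sq_nonneg _)
    (antitone_nat_of_succ_le fun j => ?_) (fun j => ?_) n
  · rw [hsucc]
    gcongr
    exact hQ1 _
  · rw [← hdiff]
    exact sq_nonneg _

theorem le_average_add_sqrt_sum_sq_sub (a : ℕ → ℝ) (n : ℕ) :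
    a n ≤ ((n + 1 : ℕ) : ℝ)⁻¹ * ∑ k ∈ Finset.range (n + 1), a k +
      √(∑ k ∈ Finset.range n, ((k : ℝ) + 1) * (a k - a (k + 1)) ^ 2) := by
  set S := ∑ k ∈ Finset.range n, ((k : ℝ) + 1) * (a k - a (k + 1)) ^ 2
  have hS : 0 ≤ S := Finset.sum_nonneg fun k _ => by positivity
  have abel : ∑ k ∈ Finset.range n, ((k : ℝ) + 1) * (a k - a (k + 1)) =
      ∑ k ∈ Finset.range (n + 1), a k - (n + 1) * a n := by
    induction n with
    | zero => simp
    | succ n ih =>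
      rw [Finset.sum_range_succ, ih (Finset.sum_nonneg fun k _ => by positivity),
        Finset.sum_range_succ _ (n + 1)]
      push_cast
      ring
  have hweights : ∑ k ∈ Finset.range n, ((k : ℝ) + 1) ≤ (n + 1) * (n + 1) := by
    refine (Finset.sum_le_card_nsmul _ _ ((n : ℝ) + 1) fun k hk => ?_).trans ?_
    · have : (k : ℝ) ≤ n := by exact_mod_cast (Finset.mem_range.mp hk).le
      linarith
    · rw [Finset.card_range, nsmul_eq_mul]
      gcongr
      linarith
  have cauchySchwarz : (∑ k ∈ Finset.range n, ((k : ℝ) + 1) * (a k - a (k + 1))) ^ 2 ≤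
      ((n + 1) * √S) ^ 2 := by
    rw [mul_pow, Real.sq_sqrt hS, sq (n + 1 : ℝ)]
    refine (Finset.sum_sq_le_sum_mul_sum_of_sq_le_mul _ (fun k _ => by positivity)
      (fun k _ => by positivity) fun k _ => le_of_eq (by ring)).trans
      (mul_le_mul_of_nonneg_right hweights hS)
  have hlow := (abs_le_of_sq_le_sq' cauchySchwarz (by positivity)).1
  rw [abel] at hlow
  rw [← mul_le_mul_iff_right₀ (by positivity : (0 : ℝ) < (n + 1 : ℕ)), mul_add, ← mul_assoc,
    mul_inv_cancel₀ (by positivity)]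
  push_cast
  linarith

end SquareFunction

namespace IsSymmPosContraction

variable {X : Type*} {Q : ℓ²(X, ℝ) →ₗ[ℝ] ℓ²(X, ℝ)}

theorem exists_sq_pow_le_cesaroMean_add (hQ : IsSymmPosContraction Q) (J : ℕ) (f : ℓ²(X, ℝ)) :
    ∃ S : ℓ²(X, ℝ), ‖S‖ ≤ ‖f‖ ∧
      ∀ n ≤ J, ⇑(((Q ^ 2) ^ n) f) ≤ ⇑(cesaroMean (Q ^ 2) (n + 1) f + S) := by
  obtain ⟨S, hS, hSnorm⟩ := exists_l2_sqrt_sum_sq (Finset.range J) (w := fun k => (k : ℝ) + 1)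
    (fun k _ => by positivity) fun k => (Q ^ (2 * k)) f - (Q ^ (2 * k + 2)) f
  refine ⟨S, le_of_sq_le_sq ?_ (norm_nonneg f), fun n hn x => ?_⟩
  · rw [hSnorm]
    exact sum_succ_mul_norm_pow_sub_pow_sq_le hQ.isSymmetric hQ.norm_le f J
  · refine (le_average_add_sqrt_sum_sq_sub (fun k => ((Q ^ 2) ^ k) f x) n).trans ?_
    rw [lp.coeFn_add, Pi.add_apply, cesaroMean_apply_apply, hS]
    simp only [← pow_mul, mul_add, mul_one, lp.coeFn_sub, Pi.sub_apply]
    gcongr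

theorem exists_sq_pow_majorant (hQ : IsSymmPosContraction Q) (J : ℕ) {f : ℓ²(X, ℝ)}
    (hf : 0 ≤ ⇑f) :
    ∃ F : ℓ²(X, ℝ), ‖F‖ ≤ 13 * ‖f‖ ∧ ∀ n ≤ J, ⇑(((Q ^ 2) ^ n) f) ≤ ⇑F := by
  obtain ⟨C, hC, hCle⟩ := (hQ.pow 2).hasDyadicCesaroBound_six J f hf
  obtain ⟨S, hS, hSle⟩ := hQ.exists_sq_pow_le_cesaroMean_add J f
  refine ⟨(2 : ℝ) • C + S, ?_, fun n hn => (hSle n hn).trans ?_⟩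
  · have := norm_add_le ((2 : ℝ) • C) S
    rw [norm_smul, Real.norm_two] at this
    linarith
  · have hup : 2 ^ n.size ≤ 2 * (n + 1) := by
      rcases hm : n.size with _ | m
      · omega
      · have := Nat.lt_size.mp (hm ▸ m.lt_succ_self : m < n.size)
        omega
    have hdyadic :
        ⇑(cesaroMean (Q ^ 2) (n + 1) f) ≤ ⇑((2 : ℝ) • cesaroMean (Q ^ 2) (2 ^ n.size) f) :=
      (hQ.pow 2).pow_cesaroMean_le (j := 0) (by have := n.lt_size_self; omega) hup hf
    have hC' := hCle n.size ((Nat.size_le.mpr n.lt_two_pow_self).trans hn)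
    intro x
    have h1 := hdyadic x
    have h2 := hC' x
    simp only [lp.coeFn_add, lp.coeFn_smul, Pi.add_apply, Pi.smul_apply, smul_eq_mul] at h1 ⊢
    linarith

theorem exists_pow_majorant (hQ : IsSymmPosContraction Q) (J : ℕ) {f : ℓ²(X, ℝ)}
    (hf : 0 ≤ ⇑f) :
    ∃ F : ℓ²(X, ℝ), ‖F‖ ≤ 26 * ‖f‖ ∧ ∀ n ≤ J, ⇑((Q ^ n) f) ≤ ⇑F := by
  obtain ⟨F, hF, hFle⟩ := hQ.exists_sq_pow_majorant J hf
  obtain ⟨G, hG, hGle⟩ := hQ.exists_sq_pow_majorant J (hQ.nonneg f hf)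
  have hF0 : 0 ≤ ⇑F := hf.trans (hFle 0 J.zero_le)
  have hG0 : 0 ≤ ⇑G := (hQ.nonneg f hf).trans (hGle 0 J.zero_le)
  refine ⟨F + G, ?_, fun n hn => ?_⟩
  · linarith [norm_add_le F G, hQ.norm_le f]
  · obtain ⟨m, rfl | rfl⟩ := n.even_or_odd'
    · rw [pow_mul]
      exact le_add_of_le_of_nonneg (hFle m (by omega)) hG0
    · rw [pow_succ, pow_mul]
      exact le_add_of_nonneg_of_le hF0 (hGle m (by omega))

end IsSymmPosContraction

section Walk

/-- Translation by `u` on `ℓ²(X)`. -/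
noncomputable def l2Shift {X : Type*} [AddGroup X] (u : X) : ℓ²(X, ℝ) →ₗ[ℝ] ℓ²(X, ℝ) where
  toFun f := ⟨fun x => f (x - u), memℓp_two_of_summable_sq <|
    (l2_hasSum_sq f).summable.comp_injective (sub_left_injective (b := u))⟩
  map_add' _ _ := rfl
  map_smul' _ _ := rfl

theorem norm_l2Shift {X : Type*} [AddGroup X] (u : X) (f : ℓ²(X, ℝ)) : ‖l2Shift u f‖ = ‖f‖ := by
  have h : ‖l2Shift u f‖ ^ 2 = ‖f‖ ^ 2 := by
    rw [← (l2_hasSum_sq _).tsum_eq, ← (l2_hasSum_sq f).tsum_eq]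
    exact (Equiv.subRight u).tsum_eq fun x => f x ^ 2
  exact (pow_left_inj₀ (norm_nonneg _) (norm_nonneg _) two_ne_zero).mp h

theorem inner_l2Shift_left {X : Type*} [AddGroup X] (u : X) (f g : ℓ²(X, ℝ)) :
    ⟪l2Shift u f, g⟫_ℝ = ⟪f, l2Shift (-u) g⟫_ℝ := by
  rw [lp.inner_eq_tsum, lp.inner_eq_tsum,
    ← (Equiv.subRight u).tsum_eq fun x => ⟪f x, l2Shift (-u) g x⟫_ℝ]
  refine tsum_congr fun x => ?_
  change ⟪f (x - u), g x⟫_ℝ = ⟪f (x - u), g (x - u - -u)⟫_ℝ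
  rw [sub_neg_eq_add, sub_add_cancel]

theorem isSymmPosContraction_half_l2Shift_add {X : Type*} [AddGroup X] (u : X) :
    IsSymmPosContraction ((2 : ℝ)⁻¹ • (l2Shift u + l2Shift (-u))) where
  isSymmetric f g := by
    simp only [LinearMap.smul_apply, LinearMap.add_apply, real_inner_smul_left,
      real_inner_smul_right, inner_add_left, inner_add_right, inner_l2Shift_left, neg_neg]
    ring
  nonneg f hf x := mul_nonneg (by positivity) (add_nonneg (hf _) (hf _))
  norm_le f := by
    have h := norm_add_le (l2Shift u f) (l2Shift (-u) f)
    rw [norm_l2Shift, norm_l2Shift] at h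
    rw [LinearMap.smul_apply, LinearMap.add_apply, norm_smul, norm_inv, Real.norm_two]
    linarith

/-- The transition operator of the simple random walk on `ℤ^d`. -/
noncomputable def walk (d : ℕ) : ℓ²(Fin d → ℤ, ℝ) →ₗ[ℝ] ℓ²(Fin d → ℤ, ℝ) :=
  ∑ i : Fin d, (d : ℝ)⁻¹ • (2 : ℝ)⁻¹ • (l2Shift (Pi.single i 1) + l2Shift (-Pi.single i 1))

theorem isSymmPosContraction_walk (d : ℕ) : IsSymmPosContraction (walk d) :=
  .weighted_sum (fun _ _ => by positivity) (by simpa using mul_inv_le_one) fun i _ =>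
    isSymmPosContraction_half_l2Shift_add (Pi.single i 1)

theorem two_mul_walk_apply {d : ℕ} (f : ℓ²(Fin d → ℤ, ℝ)) (x : Fin d → ℤ) :
    2 * d * walk d f x = ∑ i, ∑ s : ℤˣ, f (x - Pi.single i (s : ℤ)) := by
  rw [walk, LinearMap.sum_apply, l2_sum_apply, Finset.mul_sum]
  refine Finset.sum_congr rfl fun i _ => ?_
  have hd : (d : ℝ) ≠ 0 := by exact_mod_cast i.pos.ne'
  rw [UnitsInt.univ, Finset.sum_pair (by decide : (1 : ℤˣ) ≠ -1), Units.val_neg, Units.val_one,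
    Pi.single_neg]
  change 2 * d * ((d : ℝ)⁻¹ * (2⁻¹ * (f (x - Pi.single i 1) + f (x - -Pi.single i 1)))) = _
  field_simp

end Walk

section SignVectors

variable {d k : ℕ}

/-- The `ℓ¹` norm of a lattice point. -/
def latticeNorm (y : Fin d → ℤ) : ℕ := ∑ i, (y i).natAbs

/-- The vectors with entries in `{-1, 0, 1}`, exactly `k` of them nonzero. -/
def signVectors (d k : ℕ) : Finset (Fin d → ℤ) :=
  {y ∈ Fintype.piFinset fun _ => {-1, 0, 1} | latticeNorm y = k}

theorem mem_signVectors {y : Fin d → ℤ} :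
    y ∈ signVectors d k ↔ (∀ i, (y i).natAbs ≤ 1) ∧ latticeNorm y = k := by
  simp only [signVectors, Finset.mem_filter, Fintype.mem_piFinset, Finset.mem_insert,
    Finset.mem_singleton]
  exact and_congr_left fun _ => forall_congr' fun i => by omega

theorem signVectors_zero (d : ℕ) : signVectors d 0 = {0} := by
  ext y
  simp +contextual [mem_signVectors, latticeNorm, Finset.sum_eq_zero_iff, funext_iff]

theorem add_single_mem_signVectors {y : Fin d → ℤ} {i : Fin d} (hy : y i = 0) (s : ℤˣ) :
    y + Pi.single i (s : ℤ) ∈ signVectors d (k + 1) ↔ y ∈ signVectors d k := by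
  have hentry : ∀ j, ((y + Pi.single i (s : ℤ) : Fin d → ℤ) j).natAbs =
      (y j).natAbs + if j = i then 1 else 0 := fun j => by
    by_cases hj : j = i
    · subst hj
      simp [hy]
    · simp [hj]
  simp only [mem_signVectors, latticeNorm, hentry, Finset.sum_add_distrib, Finset.sum_ite_eq',
    Finset.mem_univ, if_true, Nat.add_right_cancel_iff]
  refine and_congr_left fun _ => forall_congr' fun j => ?_
  by_cases hj : j = i
  · simp [hj, hy]
  · simp [hj]

theorem sum_signVectors_filter_eq_unit {M : Type*} [AddCommMonoid M] (g : (Fin d → ℤ) → M)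
    (i : Fin d) (s : ℤˣ) :
    ∑ y ∈ signVectors d (k + 1) with y i = (s : ℤ), g y =
      ∑ y ∈ signVectors d k with y i = 0, g (y + Pi.single i (s : ℤ)) := by
  refine (Finset.sum_equiv (Equiv.addRight (Pi.single i (s : ℤ) : Fin d → ℤ)) (fun y => ?_)
    fun _ _ => rfl).symm
  have hi : (y + Pi.single i (s : ℤ) : Fin d → ℤ) i = s ↔ y i = 0 := by simp
  rw [Finset.mem_filter, Equiv.coe_addRight, Finset.mem_filter, hi]
  exact and_congr_left fun hy => (add_single_mem_signVectors hy s).symm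

-- Each vector of `signVectors d (k + 1)` is reached once for each of its `k + 1` nonzero entries.
theorem succ_nsmul_sum_signVectors {M : Type*} [AddCommMonoid M] (g : (Fin d → ℤ) → M) :
    (k + 1) • ∑ y ∈ signVectors d (k + 1), g y =
      ∑ i, ∑ s : ℤˣ, ∑ y ∈ signVectors d k with y i = 0, g (y + Pi.single i (s : ℤ)) := by
  have hcount : ∀ y ∈ signVectors d (k + 1),
      (k + 1) • g y = ∑ i, ∑ s : ℤˣ, if y i = (s : ℤ) then g y else 0 := fun y hy => by
    obtain ⟨hle, hnorm⟩ := mem_signVectors.mp hy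
    rw [← hnorm, latticeNorm, Finset.sum_smul]
    refine Finset.sum_congr rfl fun i _ => ?_
    rw [UnitsInt.univ, Finset.sum_pair (by decide : (1 : ℤˣ) ≠ -1)]
    obtain h | h | h : y i = -1 ∨ y i = 0 ∨ y i = 1 := by have := hle i; omega
    all_goals simp [h]
  simp only [← sum_signVectors_filter_eq_unit g, Finset.sum_filter, Finset.smul_sum]
  rw [Finset.sum_congr rfl hcount, Finset.sum_comm]
  exact Finset.sum_congr rfl fun i _ => Finset.sum_comm

theorem card_zeros_of_mem_signVectors {y : Fin d → ℤ} (hy : y ∈ signVectors d k) :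
    (Finset.univ.filter fun i => y i = 0).card = d - k := by
  obtain ⟨hle, hnorm⟩ := mem_signVectors.mp hy
  refine Nat.eq_sub_of_add_eq ?_
  have hentry : ∀ i, (if y i = 0 then 1 else 0) + (y i).natAbs = 1 := fun i => by
    have := hle i
    split_ifs <;> omega
  rw [← hnorm, latticeNorm, Finset.card_filter, ← Finset.sum_add_distrib]
  simp [hentry]

theorem factorial_mul_card_signVectors (d k : ℕ) :
    k.factorial * (signVectors d k).card = 2 ^ k * d.descFactorial k := by
  induction k with
  | zero => simp [signVectors_zero]
  | succ k ih =>
    have hcount : (k + 1) * (signVectors d (k + 1)).card =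
        2 * ((d - k) * (signVectors d k).card) := by
      have h := succ_nsmul_sum_signVectors (d := d) (k := k) fun _ => 1
      rw [← Finset.card_eq_sum_ones, smul_eq_mul] at h
      simp only [Finset.sum_const, Finset.card_univ, Fintype.card_units_int, smul_eq_mul, mul_one,
        ← Finset.mul_sum, Finset.card_filter] at h
      rw [h, Finset.sum_comm]
      simp only [← Finset.card_filter]
      rw [Finset.sum_congr rfl fun y hy => card_zeros_of_mem_signVectors hy, Finset.sum_const,
        smul_eq_mul, mul_comm (d - k)]
    calc (k + 1).factorial * (signVectors d (k + 1)).card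
        = k.factorial * ((k + 1) * (signVectors d (k + 1)).card) := by
          rw [Nat.factorial_succ]
          ring
      _ = 2 * (d - k) * (k.factorial * (signVectors d k).card) := by
          rw [hcount]
          ring
      _ = 2 ^ (k + 1) * d.descFactorial (k + 1) := by
          rw [ih, Nat.descFactorial_succ]
          ring

theorem pow_mul_sub_sq_le_descFactorial {d k : ℕ} (hk : k ≤ d) :
    (d : ℝ) ^ k * (2 * d - k ^ 2) ≤ 2 * d * d.descFactorial k := by
  induction k with
  | zero => simp
  | succ k ih =>
    have hkd : (0 : ℝ) ≤ d - k := sub_nonneg.mpr (by exact_mod_cast (by omega : k ≤ d))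
    have hstep : (d : ℝ) * (2 * d - (k + 1) ^ 2) ≤ (d - k) * (2 * d - k ^ 2) := by
      nlinarith [pow_nonneg (k.cast_nonneg : (0 : ℝ) ≤ k) 3, (d.cast_nonneg : (0 : ℝ) ≤ d)]
    rw [Nat.descFactorial_succ]
    push_cast [Nat.cast_sub (by omega : k ≤ d)]
    calc (d : ℝ) ^ (k + 1) * (2 * d - (k + 1) ^ 2)
        = (d : ℝ) ^ k * (d * (2 * d - (k + 1) ^ 2)) := by ring
      _ ≤ (d : ℝ) ^ k * ((d - k) * (2 * d - k ^ 2)) := by gcongr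
      _ = (d - k) * ((d : ℝ) ^ k * (2 * d - k ^ 2)) := by ring
      _ ≤ (d - k) * (2 * d * d.descFactorial k) := by
          exact mul_le_mul_of_nonneg_left (ih (by omega)) hkd
      _ = 2 * d * ((d - k) * d.descFactorial k) := by ring

theorem pow_le_two_mul_descFactorial {d k : ℕ} (hk : k ^ 2 ≤ d) :
    (d : ℝ) ^ k ≤ 2 * d.descFactorial k := by
  rcases d.eq_zero_or_pos with rfl | hd
  · simp [(by simpa using hk : k = 0)]
  · have hd' : (0 : ℝ) < d := by exact_mod_cast hd
    have hk' : (k : ℝ) ^ 2 ≤ d := by exact_mod_cast hk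
    refine le_of_mul_le_mul_right ?_ hd'
    calc (d : ℝ) ^ k * d ≤ d ^ k * (2 * d - k ^ 2) := by
          gcongr
          linarith
      _ ≤ 2 * d.descFactorial k * d :=
          (pow_mul_sub_sq_le_descFactorial ((Nat.le_self_pow two_ne_zero k).trans hk)).trans_eq
            (by ring)

theorem factorial_mul_sum_signVectors_le_walk_pow {f : ℓ²(Fin d → ℤ, ℝ)} (hf : 0 ≤ ⇑f) (k : ℕ)
    (x : Fin d → ℤ) :
    k.factorial * ∑ y ∈ signVectors d k, f (x - y) ≤ (2 * d : ℝ) ^ k * (walk d ^ k) f x := by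
  induction k generalizing x with
  | zero => simp [signVectors_zero]
  | succ k ih =>
    have hstep : ∀ (i : Fin d) (s : ℤˣ), (k.factorial : ℝ) *
        ∑ y ∈ signVectors d k with y i = 0, f (x - (y + Pi.single i (s : ℤ))) ≤
          (2 * d : ℝ) ^ k * (walk d ^ k) f (x - Pi.single i (s : ℤ)) := fun i s => by
      refine le_trans ?_ (ih _)
      simp only [sub_add_eq_sub_sub_swap]
      gcongr
      exacts [fun y _ _ => hf _, Finset.filter_subset _ _]
    have hsucc := succ_nsmul_sum_signVectors (k := k) fun y => f (x - y)
    rw [nsmul_eq_mul] at hsucc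
    calc ((k + 1).factorial : ℝ) * ∑ y ∈ signVectors d (k + 1), f (x - y)
        = ∑ i, ∑ s : ℤˣ, (k.factorial : ℝ) *
            ∑ y ∈ signVectors d k with y i = 0, f (x - (y + Pi.single i (s : ℤ))) := by
          rw [Nat.factorial_succ, mul_comm (k + 1), Nat.cast_mul, mul_assoc, hsucc]
          simp only [Finset.mul_sum]
      _ ≤ ∑ i, ∑ s : ℤˣ, (2 * d : ℝ) ^ k * (walk d ^ k) f (x - Pi.single i (s : ℤ)) :=
          Finset.sum_le_sum fun i _ => Finset.sum_le_sum fun s _ => hstep i s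
      _ = (2 * d : ℝ) ^ (k + 1) * (walk d ^ (k + 1)) f x := by
          simp only [← Finset.mul_sum]
          rw [← two_mul_walk_apply, pow_succ' (walk d), Module.End.mul_apply, pow_succ (2 * d : ℝ)]
          ring

end SignVectors

section Ball

variable {d : ℕ}

theorem mem_latticeBallFinset_iff_cast_le {t : ℝ} {y : Fin d → ℤ} :
    y ∈ latticeBallFinset d t ↔ (latticeNorm y : ℝ) ≤ t := by
  have hnorm : (latticeNorm y : ℝ) = ∑ i, |(y i : ℝ)| := by
    simp only [latticeNorm, Nat.cast_sum, Nat.cast_natAbs, Int.cast_abs]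
  rw [latticeBallFinset, Set.Finite.mem_toFinset, hnorm]
  rfl

theorem mem_latticeBallFinset {N : ℕ} {y : Fin d → ℤ} :
    y ∈ latticeBallFinset d N ↔ latticeNorm y ≤ N :=
  mem_latticeBallFinset_iff_cast_le.trans Nat.cast_le

theorem latticeBallFinset_floor {t : ℝ} (ht : 0 ≤ t) :
    latticeBallFinset d (⌊t⌋₊ : ℝ) = latticeBallFinset d t := by
  ext y
  rw [mem_latticeBallFinset, Nat.le_floor_iff ht, mem_latticeBallFinset_iff_cast_le]

theorem pow_le_factorial_mul_card_latticeBallFinset {N : ℕ} (hN : N ^ 2 ≤ d) :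
    (2 * d : ℝ) ^ N ≤ 2 * N.factorial * (latticeBallFinset d N).card := by
  have hsub : signVectors d N ⊆ latticeBallFinset d N := fun y hy =>
    mem_latticeBallFinset.mpr (mem_signVectors.mp hy).2.le
  calc (2 * d : ℝ) ^ N = 2 ^ N * d ^ N := mul_pow _ _ _
    _ ≤ 2 ^ N * (2 * d.descFactorial N) := by
        gcongr
        exact pow_le_two_mul_descFactorial hN
    _ = 2 * (2 ^ N * d.descFactorial N : ℕ) := by
        push_cast
        ring
    _ = 2 * N.factorial * (signVectors d N).card := by
        rw [← factorial_mul_card_signVectors, Nat.cast_mul, mul_assoc]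
    _ ≤ 2 * N.factorial * (latticeBallFinset d N).card := by
        gcongr

theorem sum_signVectors_le_card_latticeBallFinset_mul {N j : ℕ} (hN : N ^ 2 ≤ d) (hj : j ≤ N)
    {f : ℓ²(Fin d → ℤ, ℝ)} (hf : 0 ≤ ⇑f) (x : Fin d → ℤ) :
    (2 * d : ℝ) ^ j * ∑ z ∈ signVectors d (N - j), f (x - z) ≤
      (N : ℝ) ^ j * (2 * (latticeBallFinset d N).card * (walk d ^ (N - j)) f x) := by
  have hw : 0 ≤ (walk d ^ (N - j)) f x := ((isSymmPosContraction_walk d).pow _).nonneg f hf x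
  have hfact : (N.factorial : ℝ) ≤ (N - j).factorial * (N : ℝ) ^ j := by
    rw [← Nat.factorial_mul_descFactorial hj]
    exact_mod_cast Nat.mul_le_mul_left _ (Nat.descFactorial_le_pow N j)
  refine le_of_mul_le_mul_left ?_ (by positivity : (0 : ℝ) < (N - j).factorial)
  calc (N - j).factorial * ((2 * d : ℝ) ^ j * ∑ z ∈ signVectors d (N - j), f (x - z))
      = (2 * d : ℝ) ^ j * ((N - j).factorial * ∑ z ∈ signVectors d (N - j), f (x - z)) := by ring
    _ ≤ (2 * d : ℝ) ^ j * ((2 * d : ℝ) ^ (N - j) * (walk d ^ (N - j)) f x) := by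
        exact mul_le_mul_of_nonneg_left (factorial_mul_sum_signVectors_le_walk_pow hf _ x)
          (by positivity)
    _ = (2 * d : ℝ) ^ N * (walk d ^ (N - j)) f x := by
        rw [← mul_assoc, ← pow_add, Nat.add_sub_cancel' hj]
    _ ≤ 2 * ((N - j).factorial * (N : ℝ) ^ j) * (latticeBallFinset d N).card *
          (walk d ^ (N - j)) f x := by
        gcongr
        exact (pow_le_factorial_mul_card_latticeBallFinset hN).trans (by gcongr)
    _ = _ := by ring

theorem sum_signVectors_le_card_mul_pow_mul {N j : ℕ} (hN : N ^ 2 ≤ d) (hj : j ≤ N) {q : ℝ}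
    (hNq : N ≤ 2 * d * q) {f : ℓ²(Fin d → ℤ, ℝ)} (hf : 0 ≤ ⇑f) {x : Fin d → ℤ} {c : ℝ}
    (hc : (walk d ^ (N - j)) f x ≤ c) :
    ∑ z ∈ signVectors d (N - j), f (x - z) ≤
      2 * (latticeBallFinset d N).card * (q ^ j * c) := by
  have hpos : 0 < (2 * d : ℝ) ^ j := by
    rcases d.eq_zero_or_pos with rfl | hd
    · simp [(by simpa [(by simpa using hN : N = 0)] using hj : j = 0)]
    · positivity
  have hw : 0 ≤ (walk d ^ (N - j)) f x := ((isSymmPosContraction_walk d).pow _).nonneg f hf x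
  refine le_of_mul_le_mul_left ?_ hpos
  calc _ ≤ (N : ℝ) ^ j * (2 * (latticeBallFinset d N).card * (walk d ^ (N - j)) f x) :=
        sum_signVectors_le_card_latticeBallFinset_mul hN hj hf x
    _ ≤ (2 * d * q) ^ j * (2 * (latticeBallFinset d N).card * c) := by
        gcongr
        exact pow_nonneg (N.cast_nonneg.trans hNq) j
    _ = (2 * d : ℝ) ^ j * (2 * (latticeBallFinset d N).card * (q ^ j * c)) := by
        rw [mul_pow _ q]
        ring

/-- The lattice points with entries in `[-R, R] \ {-1, 1}`. -/
noncomputable def sparseVectors (d R : ℕ) : Finset (Fin d → ℤ) :=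
  Fintype.piFinset fun _ => {j ∈ Finset.Icc (-(R : ℤ)) R | j.natAbs ≠ 1}

/-- The point `x` with its entries `±1` replaced by `0`. -/
def sparsePart (x : Fin d → ℤ) : Fin d → ℤ :=
  fun i => if (x i).natAbs = 1 then 0 else x i

theorem sub_sparsePart_apply (x : Fin d → ℤ) (i : Fin d) :
    (x - sparsePart x) i = if (x i).natAbs = 1 then x i else 0 := by
  by_cases h : (x i).natAbs = 1 <;> simp [sparsePart, h]

theorem sparsePart_mem_sparseVectors {R : ℕ} {x : Fin d → ℤ} (hx : latticeNorm x ≤ R) :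
    sparsePart x ∈ sparseVectors d R := by
  refine Fintype.mem_piFinset.mpr fun i => ?_
  have hi : (x i).natAbs ≤ latticeNorm x :=
    Finset.single_le_sum (f := fun i => (x i).natAbs) (fun _ _ => Nat.zero_le _)
      (Finset.mem_univ i)
  rw [Finset.mem_filter, Finset.mem_Icc, sparsePart]
  split_ifs <;> omega

theorem latticeNorm_sparsePart_add (x : Fin d → ℤ) :
    latticeNorm (sparsePart x) + latticeNorm (x - sparsePart x) = latticeNorm x := by
  simp only [latticeNorm, ← Finset.sum_add_distrib]
  refine Finset.sum_congr rfl fun i _ => ?_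
  rw [sub_sparsePart_apply, sparsePart]
  split_ifs <;> simp

theorem sub_sparsePart_mem_signVectors (x : Fin d → ℤ) :
    x - sparsePart x ∈ signVectors d (latticeNorm (x - sparsePart x)) := by
  refine mem_signVectors.mpr ⟨fun i => ?_, rfl⟩
  rw [sub_sparsePart_apply]
  split_ifs <;> simp [*]

theorem sum_latticeBallFinset_le {N R : ℕ} (hNR : N ≤ R) {g : (Fin d → ℤ) → ℝ} (hg : 0 ≤ g) :
    ∑ x ∈ latticeBallFinset d N, g x ≤
      ∑ y ∈ sparseVectors d R, ∑ j ∈ Finset.Ico (latticeNorm y) (N + 1),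
        ∑ z ∈ signVectors d (N - j), g (y + z) := by
  set e : (Fin d → ℤ) → (_ : (_ : Fin d → ℤ) × ℕ) × (Fin d → ℤ) := fun x =>
    ⟨⟨sparsePart x, N - latticeNorm (x - sparsePart x)⟩, x - sparsePart x⟩
  have he : ∀ x, (e x).1.1 + (e x).2 = x := fun x => add_sub_cancel _ _
  rw [Finset.sum_sigma', Finset.sum_sigma']
  calc ∑ x ∈ latticeBallFinset d N, g x
      = ∑ p ∈ (latticeBallFinset d N).image e, g (p.1.1 + p.2) := by
        rw [Finset.sum_image fun a _ b _ hab => by rw [← he a, hab, he]]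
        simp only [he]
    _ ≤ _ := by
        refine Finset.sum_le_sum_of_subset_of_nonneg (Finset.image_subset_iff.mpr fun x hx => ?_)
          fun p _ _ => hg _
        have hxN := mem_latticeBallFinset.mp hx
        have hsplit := latticeNorm_sparsePart_add x
        simp only [Finset.mem_sigma, Finset.mem_Ico, e]
        refine ⟨⟨sparsePart_mem_sparseVectors (hxN.trans hNR), by omega, by omega⟩, ?_⟩
        rw [Nat.sub_sub_self (by omega)]
        exact sub_sparsePart_mem_signVectors x

theorem sum_Ico_pow_le_two_mul_pow {q : ℝ} (hq0 : 0 ≤ q) (hq : q ≤ 1 / 2) (m n : ℕ) :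
    ∑ j ∈ Finset.Ico m n, q ^ j ≤ 2 * q ^ m := by
  refine (geom_sum_Ico_le_of_lt_one hq0 (by linarith)).trans ?_
  rw [div_le_iff₀ (by linarith)]
  nlinarith [pow_nonneg hq0 m]

theorem sum_latticeBallFinset_le_card_mul {N R : ℕ} (hN : N ^ 2 ≤ d) (hNR : N ≤ R) {q : ℝ}
    (hNq : N ≤ 2 * d * q) (hq0 : 0 ≤ q) (hq : q ≤ 1 / 2) {f F : ℓ²(Fin d → ℤ, ℝ)}
    (hf : 0 ≤ ⇑f) (hF : ∀ n ≤ R, ⇑((walk d ^ n) f) ≤ ⇑F) (x : Fin d → ℤ) :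
    ∑ y ∈ latticeBallFinset d N, f (x - y) ≤
      (latticeBallFinset d N).card *
        (4 * ∑ y ∈ sparseVectors d R, q ^ latticeNorm y * F (x - y)) := by
  have hF0 : 0 ≤ ⇑F := hf.trans (hF 0 R.zero_le)
  set B : ℝ := ((latticeBallFinset d N).card : ℝ)
  have hB : 0 ≤ B := Nat.cast_nonneg _
  have hsign : ∀ j ≤ N, ∀ y, ∑ z ∈ signVectors d (N - j), f (x - (y + z)) ≤
      2 * B * (q ^ j * F (x - y)) := fun j hj y => by
    simp only [← sub_sub]
    exact sum_signVectors_le_card_mul_pow_mul hN hj hNq hf (hF _ (by omega) _)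
  calc ∑ y ∈ latticeBallFinset d N, f (x - y)
      ≤ ∑ y ∈ sparseVectors d R, ∑ j ∈ Finset.Ico (latticeNorm y) (N + 1),
          ∑ z ∈ signVectors d (N - j), f (x - (y + z)) :=
        sum_latticeBallFinset_le hNR fun y => hf (x - y)
    _ ≤ ∑ y ∈ sparseVectors d R, ∑ j ∈ Finset.Ico (latticeNorm y) (N + 1),
          2 * B * (q ^ j * F (x - y)) := by
        gcongr with y _ j hj
        exact hsign j (by have := Finset.mem_Ico.mp hj; omega) y
    _ = ∑ y ∈ sparseVectors d R, 2 * B *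
          ((∑ j ∈ Finset.Ico (latticeNorm y) (N + 1), q ^ j) * F (x - y)) := by
        simp only [Finset.sum_mul, Finset.mul_sum]
    _ ≤ ∑ y ∈ sparseVectors d R, 2 * B * (2 * q ^ latticeNorm y * F (x - y)) := by
        gcongr with y _
        · exact hF0 _
        · exact sum_Ico_pow_le_two_mul_pow hq0 hq _ _
    _ = B * (4 * ∑ y ∈ sparseVectors d R, q ^ latticeNorm y * F (x - y)) := by
        simp only [Finset.mul_sum]
        exact Finset.sum_congr rfl fun y _ => by ring

end Ball

section SparseWeight

theorem sum_natAbs_ne_one_pow_le {q : ℝ} (hq0 : 0 ≤ q) (hq : q ≤ 1 / 2) (R : ℕ) :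
    ∑ j ∈ Finset.Icc (-(R : ℤ)) R with j.natAbs ≠ 1, q ^ j.natAbs ≤ 1 + 4 * q ^ 2 := by
  have hhalf : ∑ k ∈ Finset.range (R + 1) with k ≠ 1, q ^ k ≤ 1 + 2 * q ^ 2 := calc
    _ ≤ ∑ k ∈ insert 0 (Finset.Ico 2 (R + 1)), q ^ k :=
      Finset.sum_le_sum_of_subset_of_nonneg (fun k hk => by
        simp only [Finset.mem_filter, Finset.mem_range, Finset.mem_insert, Finset.mem_Ico] at hk ⊢
        omega) fun k _ _ => pow_nonneg hq0 k
    _ ≤ 1 + 2 * q ^ 2 := by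
      rw [Finset.sum_insert (by simp), pow_zero]
      gcongr
      exact sum_Ico_pow_le_two_mul_pow hq0 hq 2 (R + 1)
  have heven := Finset.sum_Icc_of_even_eq_range
    (f := fun j : ℤ => if j.natAbs ≠ 1 then q ^ j.natAbs else 0)
    (fun j => by simp only [Int.natAbs_neg]) R
  rw [Finset.sum_filter, heven]
  simp only [Int.natAbs_natCast, ← Finset.sum_filter, Int.natAbs_zero, pow_zero, ne_eq,
    zero_ne_one, not_false_eq_true, if_true, two_smul]
  linarith

theorem sum_sparseVectors_pow_le_exp {q : ℝ} (hq0 : 0 ≤ q) (hq : q ≤ 1 / 2) (d R : ℕ) :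
    ∑ y ∈ sparseVectors d R, q ^ latticeNorm y ≤ Real.exp (4 * d * q ^ 2) := by
  simp only [latticeNorm, ← Finset.prod_pow_eq_pow_sum]
  rw [sparseVectors, ← Finset.prod_univ_sum (fun _ : Fin d => _) fun _ (j : ℤ) => q ^ j.natAbs,
    Finset.prod_const, Finset.card_univ, Fintype.card_fin]
  calc _ ≤ Real.exp (4 * q ^ 2) ^ d := by
        refine pow_le_pow_left₀ (Finset.sum_nonneg fun j _ => pow_nonneg hq0 _) ?_ d
        refine (sum_natAbs_ne_one_pow_le hq0 hq R).trans ?_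
        linarith [Real.add_one_le_exp (4 * q ^ 2)]
    _ = Real.exp (4 * d * q ^ 2) := by
        rw [← Real.exp_nat_mul]
        ring_nf

end SparseWeight

section Majorant

theorem exists_latticeBall_average_majorant {d : ℕ} {f : ℓ²(Fin d → ℤ, ℝ)} (hf : 0 ≤ ⇑f) :
    ∃ W : ℓ²(Fin d → ℤ, ℝ), ‖W‖ ≤ 312 * ‖f‖ ∧ ∀ N : ℕ, N ^ 2 ≤ d → ∀ x,
      ∑ y ∈ latticeBallFinset d N, f (x - y) ≤ (latticeBallFinset d N).card * W x := by
  obtain ⟨F, hF, hle⟩ := (isSymmPosContraction_walk d).exists_pow_majorant d hf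
  -- `N ≤ √d = 2 d q`, while the total sparse weight is at most `exp (4 d q²) ≤ e`.
  set q : ℝ := (√d)⁻¹ / 2 with hqdef
  have hq0 : 0 ≤ q := by positivity
  have hq : q ≤ 1 / 2 := by
    have hinv : (√d)⁻¹ ≤ 1 := by
      rcases d.eq_zero_or_pos with rfl | hd
      · simp
      · exact inv_le_one_of_one_le₀ (Real.one_le_sqrt.mpr (by exact_mod_cast hd))
    linarith
  have hweight : ∑ y ∈ sparseVectors d d, q ^ latticeNorm y ≤ 3 := by
    refine (sum_sparseVectors_pow_le_exp hq0 hq d d).trans ?_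
    have hexp : 4 * d * q ^ 2 ≤ 1 := by
      rw [hqdef, div_pow, inv_pow, Real.sq_sqrt d.cast_nonneg]
      linarith [mul_inv_le_one (a := (d : ℝ))]
    linarith [Real.exp_le_exp.mpr hexp, Real.exp_one_lt_three]
  refine ⟨(4 : ℝ) • ∑ y ∈ sparseVectors d d, q ^ latticeNorm y • l2Shift y F, ?_, fun N hN x => ?_⟩
  · have hsum : ‖∑ y ∈ sparseVectors d d, q ^ latticeNorm y • l2Shift y F‖ ≤ 3 * ‖F‖ := calc
      _ ≤ ∑ y ∈ sparseVectors d d, q ^ latticeNorm y * ‖F‖ :=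
        norm_sum_le_of_le _ fun y _ => by
          rw [norm_smul, norm_l2Shift, Real.norm_of_nonneg (pow_nonneg hq0 _)]
      _ ≤ 3 * ‖F‖ := by
        rw [← Finset.sum_mul]
        gcongr
    rw [norm_smul, Real.norm_of_nonneg (by norm_num)]
    linarith
  · have hNq : (N : ℝ) ≤ 2 * d * q := by
      have h2dq : 2 * d * q = √d := calc
        2 * d * q = d / √d := by ring
        _ = √d := Real.div_sqrt
      rw [h2dq]
      exact Real.le_sqrt_of_sq_le (by exact_mod_cast hN)
    refine (sum_latticeBallFinset_le_card_mul hN ((Nat.le_self_pow two_ne_zero N).trans hN) hNq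
      hq0 hq hf hle x).trans_eq ?_
    rw [lp.coeFn_smul, Pi.smul_apply, l2_sum_apply]
    rfl

theorem norm_discreteAvg_le {d : ℕ} {t : ℝ} {f : (Fin d → ℤ) → ℂ} {x : Fin d → ℤ} {w : ℝ}
    (hw : ∑ y ∈ latticeBallFinset d t, ‖f (x - y)‖ ≤ (latticeBallFinset d t).card * w)
    (ht : 0 ≤ t) : ‖discreteAvg t f x‖ ≤ w := by
  have hzero : 0 ∈ latticeBallFinset d t := by
    simpa [mem_latticeBallFinset_iff_cast_le, latticeNorm] using ht
  have hcard : (0 : ℝ) < (latticeBallFinset d t).card := by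
    exact_mod_cast Finset.card_pos.mpr ⟨0, hzero⟩
  rw [discreteAvg, norm_mul, norm_div, norm_one, Complex.norm_natCast, one_div,
    inv_mul_le_iff₀ hcard]
  exact (norm_sum_le _ _).trans hw

theorem theorem1p3_general (d : ℕ) (f : ℓ²(Fin d → ℤ, ℂ)) :
    ∃ W : ℓ²(Fin d → ℤ, ℝ), ‖W‖ ≤ 312 * ‖f‖ ∧
      ∀ t ∈ Set.Icc 0 √(d : ℝ), ∀ x, ‖discreteAvg t f x‖ ≤ W x := by
  obtain ⟨W, hW, hle⟩ :=
    exists_latticeBall_average_majorant (f := lp.toNorm f) fun x => norm_nonneg (f x)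
  refine ⟨W, hW.trans_eq (by rw [lp.norm_toNorm]), fun t ht x => norm_discreteAvg_le ?_ ht.1⟩
  rw [← latticeBallFinset_floor ht.1]
  refine hle ⌊t⌋₊ ?_ x
  have hfloor := (Nat.floor_le ht.1).trans ht.2
  exact_mod_cast (Real.le_sqrt (Nat.cast_nonneg _) d.cast_nonneg).mp hfloor

theorem smallDyadicRadii_subset_Icc (d : ℕ) : smallDyadicRadii d ⊆ Set.Icc 0 √(d : ℝ) := by
  rintro _ ⟨⟨n, rfl⟩, hn⟩
  exact ⟨by positivity, hn⟩

theorem exists_memℓp_iSup_norm_le {X ι E : Type*} [SeminormedAddCommGroup E] {u : ι → X → E}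
    {W : ℓ²(X, ℝ)} (hW : ∀ i x, ‖u i x‖ ≤ W x) :
    ∃ h : Memℓp (fun x => ⨆ i, ‖u i x‖) 2,
      ‖(⟨fun x => ⨆ i, ‖u i x‖, h⟩ : ℓ²(X, ℝ))‖ ≤ ‖W‖ := by
  have hle : ∀ x, ‖⨆ i, ‖u i x‖‖ ≤ ‖W x‖ := fun x => by
    rw [Real.norm_of_nonneg (Real.iSup_nonneg fun i => norm_nonneg _)]
    exact Real.iSup_le (fun i => (hW i x).trans (le_abs_self _)) (abs_nonneg _)
  exact ⟨(lp.memℓp W).mono' hle, lp.norm_mono (by norm_num) hle⟩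

end Majorant

theorem theorem1p3 (d : ℕ) (hd : 4 ≤ d) (f : lp (fun _ : Fin d → ℤ => ℂ) 2) :
    ∃ h : Memℓp (smallDyadicMax (f : (Fin d → ℤ) → ℂ)) 2,
      ‖(⟨smallDyadicMax (f : (Fin d → ℤ) → ℂ), h⟩ : lp (fun _ : Fin d → ℤ => ℝ) 2)‖ ≤
        900 * ‖f‖ := by
  obtain ⟨W, hW, hle⟩ := theorem1p3_general d f
  obtain ⟨h, hnorm⟩ := exists_memℓp_iSup_norm_le fun (t : smallDyadicRadii d) x =>
    hle t (smallDyadicRadii_subset_Icc d t.2) x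
  exact ⟨h, hnorm.trans (hW.trans (by gcongr; norm_num))⟩
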